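/- Let $\mathcal M$ be a uniform oriented matroid of rank two on a ground set $E$ with $n$ elements, and let $T_1,\dots,T_n$ be topes of $\mathcal M$ (i.e. maximal covectors; repetitions are allowed). Then there exist a tope $\widetilde T$ of $\mathcal M$ and pairwise distinct elements $e_1,\dots,e_n\in E$ such that $\widetilde T(e_i)=T_i(e_i)$ for every $i\in\{1,\dots,n\}$. -/

import Mathlib

/-- Sign vectors on a ground set `E`, with entries `-1`, `0`, `1`. -/
abbrev SignVec (E : Type*) := E → SignType

namespace SignVec

/-- The composition `X ∘ Y`: the sign of `X` where it is nonzero, the sign of `Y` elsewhere. -/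
def comp {E : Type*} (X Y : SignVec E) : SignVec E :=
  fun e => if X e = 0 then Y e else X e

/-- The separation set `S(X, Y)`: the elements on which `X` and `Y` have opposite nonzero signs. -/
def sep {E : Type*} (X Y : SignVec E) : Set E :=
  {e | X e ≠ 0 ∧ X e = -Y e}

/-- The usual partial order on sign vectors: `X e ≠ 0` implies `X e = Y e`. -/
def Conforms {E : Type*} (X Y : SignVec E) : Prop :=
  ∀ e, X e ≠ 0 → X e = Y e

end SignVec

/-- An oriented matroid on the ground set `E`, given by its set of covectors. -/
structure OrientedMatroid (E : Type*) where
  /-- The set of covectors. -/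
  covectors : Set (SignVec E)
  zero_mem : (fun _ => 0) ∈ covectors
  neg_mem : ∀ X ∈ covectors, (fun e => -X e) ∈ covectors
  comp_mem : ∀ X ∈ covectors, ∀ Y ∈ covectors, SignVec.comp X Y ∈ covectors
  /-- Covector elimination. -/
  elim : ∀ X ∈ covectors, ∀ Y ∈ covectors, ∀ e ∈ SignVec.sep X Y,
    ∃ Z ∈ covectors, Z e = 0 ∧ ∀ f, f ∉ SignVec.sep X Y → Z f = SignVec.comp X Y f

namespace OrientedMatroid

/-- A tope is a maximal covector. -/
def IsTope {E : Type*} (M : OrientedMatroid E) (T : SignVec E) : Prop :=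
  T ∈ M.covectors ∧ ∀ X ∈ M.covectors, SignVec.Conforms T X → X = T

/-- Closure in the underlying matroid, whose flats are the zero sets of the covectors:
`e` lies in the closure of `A` when every covector that vanishes on `A` vanishes at `e`. -/
def closure {E : Type*} (M : OrientedMatroid E) (A : Set E) : Set E :=
  {e | ∀ X ∈ M.covectors, (∀ a ∈ A, X a = 0) → X e = 0}

/-- Independence in the underlying matroid: no element is in the closure of the others. -/
def Indep {E : Type*} (M : OrientedMatroid E) (I : Set E) : Prop :=
  ∀ e ∈ I, e ∉ M.closure (I \ {e})

theorem closure_mono {E : Type*} (M : OrientedMatroid E) {A B : Set E} (h : A ⊆ B) :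
    M.closure A ⊆ M.closure B :=
  fun _ he X hX hB => he X hX fun a ha => hB a (h ha)

theorem closure_exchange {E : Type*} (M : OrientedMatroid E) {A : Set E} {e f : E}
    (hf : f ∈ M.closure (insert e A)) (hfA : f ∉ M.closure A) :
    e ∈ M.closure (insert f A) := by
  intro Y hY hYA
  by_contra hYe
  simp only [closure, Set.mem_ofPred_eq, not_forall] at hfA
  obtain ⟨X, hX, hXA, hXf⟩ := hfA
  have hXe : X e ≠ 0 := by
    intro h0
    refine hXf (hf X hX ?_)
    rintro a (rfl | ha)
    · exact h0
    · exact hXA a ha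
  have hYf : Y f = 0 := hYA f (Set.mem_insert _ _)
  obtain ⟨W, hW, hWe, hW0⟩ : ∃ W ∈ M.covectors, X e = -W e ∧ ∀ a, Y a = 0 → W a = 0 := by
    have key : ∀ s t : SignType, s ≠ 0 → t ≠ 0 → s = -t ∨ s = t := by decide
    rcases key _ _ hXe hYe with h | h
    · exact ⟨Y, hY, h, fun _ ha => ha⟩
    · exact ⟨_, M.neg_mem Y hY, by simp [h], fun a ha => by simp [ha]⟩
  obtain ⟨Z, hZ, hZe, hZs⟩ := M.elim X hX W hW e ⟨hXe, hWe⟩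
  have hWf : W f = 0 := hW0 f hYf
  have hZf : Z f = X f := by
    rw [hZs f (fun h => h.1 (by rw [h.2, hWf]; rfl))]
    simp [SignVec.comp, hXf]
  refine hXf (hZf ▸ hf Z hZ ?_)
  rintro a (rfl | ha)
  · exact hZe
  · rw [hZs a (fun h => h.1 (hXA a ha))]
    simp [SignVec.comp, hXA a ha, hW0 a (hYA a (Set.mem_insert_of_mem _ ha))]

theorem Indep.subset {E : Type*} {M : OrientedMatroid E} {I J : Set E} (hJ : M.Indep J)
    (h : I ⊆ J) : M.Indep I :=
  fun e he hc => hJ e (h he) (M.closure_mono (Set.sdiff_subset_sdiff_left h) hc)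

theorem Indep.insert {E : Type*} {M : OrientedMatroid E} {I : Set E} {e : E} (hI : M.Indep I)
    (he : e ∉ M.closure I) : M.Indep (insert e I) := by
  have heI : e ∉ I := fun h => he fun X _ hX => hX e h
  rintro f (rfl | hf) hc
  · exact he (M.closure_mono (by rintro a ⟨rfl | ha, hne⟩; exacts [(hne rfl).elim, ha]) hc)
  · have hfe : e ≠ f := fun h => heI (h ▸ hf)
    rw [Set.insert_sdiff_of_notMem _ (by simpa using hfe)] at hc
    have h := M.closure_exchange hc (hI f hf)
    rw [Set.insert_sdiff_singleton, Set.insert_eq_of_mem hf] at h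
    exact he h

theorem Indep.ncard_le {E : Type*} [Finite E] {M : OrientedMatroid E} {I : Set E} (k : ℕ) :
    ∀ J : Set E, (J \ I).ncard = k → M.Indep J → J ⊆ M.closure I → J.ncard ≤ I.ncard := by
  induction k with
  | zero =>
    intro J hk _ _
    rw [Set.ncard_eq_zero (Set.toFinite _), Set.sdiff_eq_empty] at hk
    exact Set.ncard_le_ncard hk (Set.toFinite _)
  | succ k ih =>
    intro J hk hJ hJI
    obtain ⟨e, heJ, heI⟩ : (J \ I).Nonempty := by
      rw [← Set.ncard_pos (Set.toFinite _)]; omega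
    obtain ⟨f, hfI, hf⟩ : ∃ f ∈ I, f ∉ M.closure (J \ {e}) := by
      by_contra! hcon
      exact hJ e heJ fun X hX h0 => hJI heJ X hX fun a ha => hcon a ha X hX h0
    have hfJ : f ∉ J \ {e} := fun h => hf fun X _ hX => hX f h
    have hcard : (Insert.insert f (J \ {e})).ncard = J.ncard := by
      rw [Set.ncard_insert_of_notMem hfJ (Set.toFinite _),
        Set.ncard_sdiff_singleton_add_one heJ (Set.toFinite _)]
    rw [← hcard]
    refine ih _ ?_ ((hJ.subset Set.sdiff_subset).insert hf) ?_
    · have h1 : Insert.insert f (J \ {e}) \ I = (J \ I) \ {e} := by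
        ext a
        simp only [Set.mem_sdiff, Set.mem_insert_iff, Set.mem_singleton_iff]
        constructor
        · rintro ⟨rfl | ⟨h, h'⟩, h2⟩
          · exact absurd hfI h2
          · exact ⟨⟨h, h2⟩, h'⟩
        · rintro ⟨⟨h, h2⟩, h'⟩
          exact ⟨Or.inr ⟨h, h'⟩, h2⟩
      rw [h1]
      have := Set.ncard_sdiff_singleton_add_one (s := J \ I) ⟨heJ, heI⟩ (Set.toFinite _)
      omega
    · rintro a (rfl | ha)
      · exact fun X _ hX => hX _ hfI
      · exact hJI ha.1

/-- The underlying matroid of an oriented matroid on a finite ground set. -/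
def toMatroid {E : Type*} [Finite E] (M : OrientedMatroid E) : Matroid E :=
  (IndepMatroid.ofFinite (E := Set.univ) Set.finite_univ M.Indep
    (fun _ h => h.elim)
    (fun _ _ hJ h => hJ.subset h)
    (fun I J hI hJ hlt => by
      by_contra! hcon
      refine absurd (Indep.ncard_le (I := I) _ J rfl hJ fun e he => ?_) (not_le.2 hlt)
      by_contra hec
      exact hcon e he (fun h => hec fun X _ hX => hX e h) (hI.insert hec))
    (fun _ _ => Set.subset_univ _)).matroid

/-- The rank of an oriented matroid is the rank of its underlying matroid. -/
noncomputable def rank {E : Type*} [Finite E] (M : OrientedMatroid E) : ℕ∞ :=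
  M.toMatroid.eRank

/-- An oriented matroid of rank `r` is uniform if every set of `r` elements is a basis. -/
def IsUniform {E : Type*} [Finite E] (M : OrientedMatroid E) : Prop :=
  ∀ B : Set E, B.encard = M.rank → M.toMatroid.IsBase B

end OrientedMatroid

/-! The topes form a cycle `t k` of length `2 * n` in which consecutive topes differ in one element
and each half turn crosses every element once (`exists_tope_cycle`). Write `T i = t (p i)`, cut the
cycle at a position `a`, and take the antipodal tope `t (a + n)` as the answer. Let `d i` in `(-n,
n]` be the offset of `p i` from `a` modulo `2 * n`. Among the `n` elements crossed from `a` on, `T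
i` agrees with `t (a + n)` on the first `d i` if `d i > 0`, and on the last `-d i` if `d i < 0`.

By Hall's theorem, distinct elements can be chosen once no offset is `0` and, for each `k`, at most
`k` offsets lie in `[1, k]` and at most `k` in `[-k, -1]`. The cut comes from a cycle-lemma
argument: the walk that rises at `x` by the number of `p i` congruent to `x`, minus one, falls by
`n` per turn, and a level it crosses only once gives exactly these bounds
(`exists_unique_crossing`). -/

/-! ### Hall's condition for initial and final segments -/

theorem exists_injective_fin_two_sided {ι : Type*} [Fintype ι] {n : ℕ} (hn : Fintype.card ι = n)
    (r l : ι → ℕ) (hpos : ∀ i, 1 ≤ r i ∨ 1 ≤ l i)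
    (hr : ∀ k ≤ n, (Finset.univ.filter fun i => 1 ≤ r i ∧ r i ≤ k).card ≤ k)
    (hl : ∀ k ≤ n, (Finset.univ.filter fun i => 1 ≤ l i ∧ l i ≤ k).card ≤ k) :
    ∃ f : ι → Fin n, Function.Injective f ∧ ∀ i, (f i : ℕ) < r i ∨ n ≤ f i + l i := by
  classical
  let N : ι → Finset (Fin n) := fun i =>
    Finset.univ.filter fun x => (x : ℕ) < r i ∨ n ≤ x + l i
  have hall : ∀ S : Finset ι, S.card ≤ (S.biUnion N).card := by
    intro S
    set R := S.sup r with hR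
    set L := S.sup l with hL
    -- The neighbours of `S` contain an initial segment of length `R` and a final one of length `L`.
    -- If these overlap or meet they cover `Fin n`; otherwise `hr` and `hl` bound `S.card` by `R +
    -- L`.
    have hsub : (Finset.univ.filter fun x : Fin n => (x : ℕ) < R ∨ n ≤ x + L) ⊆ S.biUnion N := by
      intro x hx
      simp only [Finset.mem_filter, Finset.mem_univ, true_and] at hx
      simp only [Finset.mem_biUnion, N, Finset.mem_filter, Finset.mem_univ, true_and]
      rcases hx with hx | hx
      · obtain ⟨i, hi, h⟩ := (Finset.lt_sup_iff).1 hx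
        exact ⟨i, hi, Or.inl h⟩
      · have hx' : n - x - 1 < S.sup l := by have := x.2; omega
        obtain ⟨i, hi, h⟩ := (Finset.lt_sup_iff).1 hx'
        exact ⟨i, hi, Or.inr (by omega)⟩
    refine le_trans ?_ (Finset.card_le_card hsub)
    by_cases hRL : n ≤ R + L
    · have : (Finset.univ.filter fun x : Fin n => (x : ℕ) < R ∨ n ≤ x + L) = Finset.univ := by
        ext x; simp only [Finset.mem_filter, Finset.mem_univ, true_and, iff_true]; omega
      rw [this, Finset.card_univ, Fintype.card_fin, ← hn]
      exact Finset.card_le_univ S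
    · have h1 : S ⊆ (Finset.univ.filter fun i => 1 ≤ r i ∧ r i ≤ R) ∪
          (Finset.univ.filter fun i => 1 ≤ l i ∧ l i ≤ L) := by
        intro i hi
        have := Finset.le_sup (f := r) hi
        have := Finset.le_sup (f := l) hi
        have := hpos i
        simp only [Finset.mem_union, Finset.mem_filter, Finset.mem_univ, true_and]
        omega
      have h2 := (Finset.card_le_card h1).trans (Finset.card_union_le _ _)
      have h3 := hr R (by omega)
      have h4 := hl L (by omega)
      have h5 : R + L ≤ (Finset.univ.filter fun x : Fin n => (x : ℕ) < R ∨ n ≤ x + L).card := by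
        have himg : (Finset.range R ∪ Finset.Ico (n - L) n) ⊆
            (Finset.univ.filter fun x : Fin n => (x : ℕ) < R ∨ n ≤ x + L).image
              (fun x : Fin n => (x : ℕ)) := by
          intro y hy
          simp only [Finset.mem_union, Finset.mem_range, Finset.mem_Ico] at hy
          simp only [Finset.mem_image, Finset.mem_filter, Finset.mem_univ, true_and]
          exact ⟨⟨y, by omega⟩, by simp only; omega, rfl⟩
        have hdisj : Disjoint (Finset.range R) (Finset.Ico (n - L) n) := by
          rw [Finset.disjoint_left]
          intro y hy hy'
          simp only [Finset.mem_range, Finset.mem_Ico] at hy hy'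
          omega
        have := (Finset.card_le_card himg).trans Finset.card_image_le
        rw [Finset.card_union_of_disjoint hdisj, Finset.card_range, Nat.card_Ico] at this
        omega
      omega
  obtain ⟨f, hf, hfN⟩ := (Finset.all_card_le_biUnion_card_iff_exists_injective N).1 hall
  exact ⟨f, hf, fun i => by simpa [N] using hfN i⟩

/-! ### The periodic walk and its unique crossing -/

/-- The walk with up-steps counting the residues `p i` modulo `2 * n` and unit drift down. -/
def residueWalk {n : ℕ} (p : Fin n → ℤ) (x : ℤ) : ℤ :=
  ∑ i, (x - 1 - p i) / (2 * n : ℤ) - x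

/-- Per turn, each of the `n` floors gains one and the drift loses `2 * n`. -/
theorem residueWalk_add_mul {n : ℕ} (hn : 0 < n) (p : Fin n → ℤ) (x m : ℤ) :
    residueWalk p (x + 2 * n * m) = residueWalk p x - n * m := by
  have h : ∀ i, (x + 2 * n * m - 1 - p i) / (2 * n : ℤ) = (x - 1 - p i) / (2 * n : ℤ) + m := by
    intro i
    rw [← Int.add_mul_ediv_left _ _ (by omega : (2 * n : ℤ) ≠ 0)]
    congr 1; ring
  simp only [residueWalk, h, Finset.sum_add_distrib, Finset.sum_const, Finset.card_univ,
    Fintype.card_fin, nsmul_eq_mul]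
  ring

/-- The floor of index `i` grows from `x` to `y` by the number of translates of `p i` in `[x, y)`.
-/
theorem card_add_residueWalk_le {n : ℕ} (hn : 0 < n) (p : Fin n → ℤ) {x y : ℤ} (hxy : x ≤ y)
    (S : Finset (Fin n)) (hS : ∀ i ∈ S, ∃ m : ℤ, x ≤ p i + 2 * n * m ∧ p i + 2 * n * m < y) :
    (S.card : ℤ) + residueWalk p x + x ≤ residueWalk p y + y := by
  classical
  have hn' : (0 : ℤ) < 2 * n := by omega
  have h : ∀ i, (if i ∈ S then 1 else 0) + (x - 1 - p i) / (2 * n : ℤ) ≤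
      (y - 1 - p i) / (2 * n : ℤ) := by
    intro i
    split_ifs with hi
    · obtain ⟨m, h1, h2⟩ := hS i hi
      have h3 : (x - 1 - p i) / (2 * n : ℤ) < m := Int.ediv_lt_of_lt_mul hn' (by nlinarith)
      have h4 : m ≤ (y - 1 - p i) / (2 * n : ℤ) := (Int.le_ediv_iff_mul_le hn').2 (by nlinarith)
      omega
    · rw [zero_add]
      exact Int.ediv_le_ediv hn' (by omega)
  have := Finset.sum_le_sum fun i (_ : i ∈ Finset.univ) => h i
  rw [Finset.sum_add_distrib] at this
  simp only [Finset.sum_ite_mem, Finset.univ_inter, Finset.sum_const, nsmul_eq_mul, mul_one] at this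
  simp only [residueWalk]
  omega

/-- The mean slope is `-1/2`; boundedness of the deviation makes first and last passages exist. -/
theorem residueWalk_bound {n : ℕ} (hn : 0 < n) (p : Fin n → ℤ) :
    ∃ B : ℤ, ∀ x, 2 * residueWalk p x ≤ B - x ∧ -B - x ≤ 2 * residueWalk p x := by
  have hn' : (0 : ℤ) < 2 * n := by omega
  have hn1 : (1 : ℤ) ≤ n := by omega
  refine ⟨|∑ i, (1 + p i)| + 2 * n * n, fun x => ?_⟩
  set P := ∑ i, (1 + p i) with hP
  have e : ∑ i : Fin n, (x - 1 - p i) = n * x - P := by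
    have : ∀ i, x - 1 - p i = x - (1 + p i) := fun i => by ring
    simp only [this, Finset.sum_sub_distrib, Finset.sum_const, Finset.card_univ,
      Fintype.card_fin, nsmul_eq_mul, hP]
  have h1 : 2 * n * ∑ i, (x - 1 - p i) / (2 * n : ℤ) ≤ n * x - P := by
    rw [← e, Finset.mul_sum]
    exact Finset.sum_le_sum fun i _ => Int.mul_ediv_self_le (by omega)
  have h2 : n * x - P - 2 * n * n ≤ 2 * n * ∑ i, (x - 1 - p i) / (2 * n : ℤ) := by
    have : ∑ i : Fin n, (x - 1 - p i - 2 * n) ≤ ∑ i, 2 * n * ((x - 1 - p i) / (2 * n : ℤ)) :=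
      Finset.sum_le_sum fun i _ => by
        have := Int.lt_mul_ediv_self_add (x := x - 1 - p i) hn'
        linarith
    rw [Finset.sum_sub_distrib, e] at this
    rw [Finset.mul_sum]
    simp only [Finset.sum_const, Finset.card_univ, Fintype.card_fin, nsmul_eq_mul] at this
    linarith
  have hF : residueWalk p x = ∑ i, (x - 1 - p i) / (2 * n : ℤ) - x := rfl
  set F := residueWalk p x
  have h3 := neg_abs_le P
  have h4 := le_abs_self P
  have h5 := abs_nonneg P
  constructor
  · by_contra! hc
    have : (n : ℤ) * (2 * F + x) ≤ |P| := by nlinarith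
    nlinarith
  · by_contra! hc
    have : -(|P| + 2 * n * n) ≤ (n : ℤ) * (2 * F + x) := by nlinarith
    nlinarith

theorem residueWalk_le_succ {n : ℕ} (hn : 0 < n) (p : Fin n → ℤ) (x : ℤ) :
    residueWalk p x ≤ residueWalk p (x + 1) + 1 := by
  have := card_add_residueWalk_le hn p (by omega : x ≤ x + 1) ∅ (by simp)
  simp at this
  omega

/-- A level crossed exactly once downwards by the walk. -/
theorem exists_unique_crossing {n : ℕ} (hn : 0 < n) (p : Fin n → ℤ) :
    ∃ a : ℤ, (∀ y, a < y → residueWalk p y < residueWalk p a) ∧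
      ∀ x ≤ a, residueWalk p (a + 1) < residueWalk p x := by
  classical
  set F := residueWalk p with hF
  obtain ⟨B, hB⟩ := residueWalk_bound hn p
  have step := residueWalk_le_succ hn p
  rw [← hF] at hB step
  -- Last time at level `v`; since the walk falls by at most one per step, no level is skipped.
  have hlast : ∀ v : ℤ, ∃ a, F a = v ∧ ∀ y, a < y → F y < F a := by
    intro v
    obtain ⟨a, ha, hmax⟩ := Int.exists_greatest_of_bdd (P := fun x => v ≤ F x)
      ⟨B - 2 * v, fun z hz => by have := (hB z).1; omega⟩
      ⟨-B - 2 * v, by have := (hB (-B - 2 * v)).2; omega⟩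
    have h1 : ∀ y, a < y → F y < v := fun y hy => by
      by_contra! h; have := hmax y h; omega
    have := h1 (a + 1) (by omega)
    have := step a
    have e : F a = v := by omega
    exact ⟨a, e, fun y hy => e ▸ h1 y hy⟩
  -- First descent from level `v` to `v - 1`.
  have hfirst : ∀ v : ℤ, ∃ a, F a = v ∧ F (a + 1) = v - 1 ∧ ∀ x ≤ a, F (a + 1) < F x := by
    intro v
    obtain ⟨b, hb, hmin⟩ := Int.exists_least_of_bdd (P := fun x => F x < v)
      ⟨-B - 2 * v, fun z hz => by have := (hB z).2; omega⟩
      ⟨B - 2 * v + 1, by have := (hB (B - 2 * v + 1)).1; omega⟩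
    have h1 : ∀ y, y < b → v ≤ F y := fun y hy => by
      by_contra! h; have := hmin y h; omega
    have h2 := h1 (b - 1) (by omega)
    have h3 := step (b - 1)
    rw [sub_add_cancel] at h3
    refine ⟨b - 1, by omega, by rw [sub_add_cancel]; omega, fun x hx => ?_⟩
    rw [sub_add_cancel]
    have := h1 x (by omega)
    omega
  by_contra! hno
  choose ra hra hra' using hlast
  choose la hla hla1 hla' using hfirst
  have hn' : (0 : ℤ) < 2 * n := by omega
  have shift : ∀ x m, F (x + 2 * n * m) = F x - n * m := residueWalk_add_mul hn p
  have modeq : ∀ {x y : ℤ}, x % (2 * n) = y % (2 * n) → ∃ m, x = y + 2 * n * m := by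
    intro x y h
    obtain ⟨m, hm⟩ := Int.dvd_of_emod_eq_zero (Int.emod_eq_emod_iff_emod_sub_eq_zero.1 h)
    exact ⟨m, by linarith⟩
  -- One turn falls by `n`, so `n` consecutive levels have inequivalent last passages, and likewise
  -- first descents.
  let g : Fin n × Bool → ℤ := fun q => if q.2 then ra q.1 % (2 * n) else la q.1 % (2 * n)
  have level : ∀ {v w : Fin n} {m : ℤ}, (v : ℤ) = w - n * m → v = w := by
    intro v w m h
    have h1 := v.2
    have h2 := w.2
    have : m = 0 := by
      rcases lt_trichotomy m 0 with h0 | h0 | h0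
      · nlinarith
      · exact h0
      · nlinarith
    subst this
    ext; omega
  -- A last passage congruent to a first descent would be a unique crossing.
  have hmix : ∀ v w m, ra v = la w + 2 * n * m → False := by
    intro v w m h
    obtain ⟨x, hx, hx'⟩ := hno (ra v) (hra' v)
    have h1 := hla' w (x - 2 * n * m) (by omega)
    have h2 := shift (x - 2 * n * m) m
    have h3 := shift (la w + 1) m
    rw [sub_add_cancel] at h2
    rw [show la w + 1 + 2 * n * m = ra v + 1 by rw [h]; ring] at h3
    omega
  have hg : Function.Injective g := by
    rintro ⟨v, b⟩ ⟨w, c⟩ h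
    cases b <;> cases c <;> simp only [g, if_true, Bool.false_eq_true, if_false] at h <;>
      obtain ⟨m, hm⟩ := modeq h
    · have := shift (la w) m
      rw [← hm, hla, hla] at this
      rw [level this]
    · obtain ⟨m, hm⟩ := modeq h.symm
      exact (hmix _ _ _ hm).elim
    · exact (hmix _ _ _ hm).elim
    · have := shift (ra w) m
      rw [← hm, hra, hra] at this
      rw [level this]
  let i₀ : Fin n := ⟨0, hn⟩
  have hstep : ∀ x m, x = p i₀ + 2 * n * m → F x ≤ F (x + 1) := by
    intro x m h
    have := card_add_residueWalk_le hn p (by omega : x ≤ x + 1) {i₀} (by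
      intro i hi
      rw [Finset.mem_singleton] at hi
      subst hi
      exact ⟨m, by omega, by omega⟩)
    simp only [Finset.card_singleton, ← hF] at this
    push_cast at this
    omega
  -- All `2 * n` residues are down-steps, but the residue of `p i₀` is not: pigeonhole.
  have himg : Finset.univ.image g ⊆ (Finset.Ico 0 (2 * n : ℤ)).erase (p i₀ % (2 * n)) := by
    intro x hx
    obtain ⟨⟨v, b⟩, -, rfl⟩ := Finset.mem_image.1 hx
    rw [Finset.mem_erase, Finset.mem_Ico]
    cases b <;> simp only [g, if_true, Bool.false_eq_true, if_false]
    · refine ⟨fun h => ?_, Int.emod_nonneg _ (by omega), Int.emod_lt_of_pos _ hn'⟩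
      obtain ⟨m, hm⟩ := modeq h
      have := hstep _ m hm
      rw [hla, hla1] at this
      omega
    · refine ⟨fun h => ?_, Int.emod_nonneg _ (by omega), Int.emod_lt_of_pos _ hn'⟩
      obtain ⟨m, hm⟩ := modeq h
      have := hstep _ m hm
      have := hra' v (ra v + 1) (by omega)
      omega
  have hc := Finset.card_le_card himg
  rw [Finset.card_image_of_injective _ hg, Finset.card_erase_of_mem (Finset.mem_Ico.2
    ⟨Int.emod_nonneg _ (by omega), Int.emod_lt_of_pos _ hn'⟩), Int.card_Ico, Finset.card_univ,
    Fintype.card_prod, Fintype.card_fin, Fintype.card_bool] at hc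
  omega

/-! ### Signs and the block pattern -/

theorem SignType.eq_or_eq_neg_of_ne_zero : ∀ s t : SignType, s ≠ 0 → t ≠ 0 → s = t ∨ s = -t := by
  decide

theorem SignType.ne_neg_of_ne_zero : ∀ s : SignType, s ≠ 0 → s ≠ -s := by decide

/-- The sign pattern of period `2 * n` that is negative exactly on the blocks `[1, n] + 2 * n * m`. -/
def blockSign (n : ℕ) (x : ℤ) : SignType := if Even ((x - 1) / (n : ℤ)) then -1 else 1

theorem blockSign_add_mul {n : ℕ} (hn : 0 < n) (x q : ℤ) :
    blockSign n (x + n * q) = (if Even q then 1 else -1) * blockSign n x := by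
  have h : (x + n * q - 1) / (n : ℤ) = (x - 1) / n + q := by
    rw [← Int.add_mul_ediv_left _ _ (by omega : (n : ℤ) ≠ 0)]
    congr 1; ring
  simp only [blockSign, h, Int.even_add]
  by_cases h1 : Even ((x - 1) / (n : ℤ)) <;> by_cases h2 : Even q <;> simp [h1, h2]

theorem blockSign_of_pos {n : ℕ} {x : ℤ} (h1 : 1 ≤ x) (h2 : x ≤ n) : blockSign n x = -1 := by
  have : (x - 1) / (n : ℤ) = 0 := Int.ediv_eq_zero_of_lt (by omega) (by omega)
  simp [blockSign, this]

theorem blockSign_of_nonpos {n : ℕ} (hn : 0 < n) {x : ℤ} (h1 : x ≤ 0) (h2 : -n < x) :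
    blockSign n x = 1 := by
  have h := blockSign_add_mul hn x 1
  rw [blockSign_of_pos (by omega) (by omega)] at h
  revert h
  simp only [Int.not_even_one, if_false]
  generalize blockSign n x = s
  revert s; decide

theorem Fin.exists_forall_iff_lt_of_lower {n : ℕ} (P : Fin n → Prop)
    (hP : ∀ i j, i ≤ j → P j → P i) : ∃ k ≤ n, ∀ i : Fin n, P i ↔ (i : ℕ) < k := by
  classical
  have hex : ∃ k, ∀ h : k < n, ¬ P ⟨k, h⟩ := ⟨n, fun h => (lt_irrefl _ h).elim⟩
  refine ⟨Nat.find hex, Nat.find_min' hex fun h => (lt_irrefl _ h).elim, fun i => ⟨fun hi => ?_, ?_⟩⟩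
  · by_contra! hc
    exact Nat.find_spec hex (lt_of_le_of_lt hc i.2) (hP _ i hc hi)
  · intro hi
    have := Nat.find_min hex hi
    push Not at this
    exact this.2

/-! ### Covectors of a uniform oriented matroid of rank two -/

namespace OrientedMatroid

variable {E : Type*} {M : OrientedMatroid E}

theorem toMatroid_indep_iff [Finite E] {I : Set E} : M.toMatroid.Indep I ↔ M.Indep I := by
  rfl

/-- Any two elements span, every element is the zero set of a covector, and there are at least two
elements. -/
structure IsUniformRankTwo (M : OrientedMatroid E) : Prop where
  eq_zero : ∀ X ∈ M.covectors, ∀ e f, e ≠ f → X e = 0 → X f = 0 → ∀ g, X g = 0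
  exists_cocircuit : ∀ e, ∃ X ∈ M.covectors, X e = 0 ∧ ∀ f, f ≠ e → X f ≠ 0
  exists_ne : ∀ e : E, ∃ f, f ≠ e

theorem isUniformRankTwo [Finite E] (hunif : M.IsUniform) (hrank : M.rank = 2) :
    M.IsUniformRankTwo := by
  have hbase : ∀ e f : E, e ≠ f → M.toMatroid.IsBase {e, f} := fun e f h =>
    hunif _ (by rw [hrank, Set.encard_pair h])
  have hzero : ∀ X ∈ M.covectors, ∀ e f, e ≠ f → X e = 0 → X f = 0 → ∀ g, X g = 0 := by
    intro X hX e f hef he hf g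
    have hXB : ∀ a ∈ ({e, f} : Set E), X a = 0 := by
      rintro a (rfl | rfl)
      exacts [he, hf]
    by_cases hg : g ∈ ({e, f} : Set E)
    · exact hXB g hg
    · by_contra hXg
      have hB := hbase e f hef
      -- A covector vanishing at `e` and `f` but not at `g` would enlarge the basis `{e, f}`.
      have hI : M.toMatroid.Indep (insert g {e, f}) :=
        toMatroid_indep_iff.2 ((toMatroid_indep_iff.1 hB.indep).insert
          fun h => hXg (h X hX hXB))
      exact hg (hB.eq_of_subset_indep hI (Set.subset_insert _ _) ▸ Set.mem_insert _ _)
  have hne : ∀ e : E, ∃ f, f ≠ e := by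
    intro e
    obtain ⟨B, hB⟩ := M.toMatroid.exists_isBase
    have h2 : B.encard = 2 := by rw [hB.encard_eq_eRank]; exact hrank
    obtain ⟨x, y, hxy, -⟩ := Set.encard_eq_two.1 h2
    by_cases h : x = e
    · exact ⟨y, fun h' => hxy (h.trans h'.symm)⟩
    · exact ⟨x, h⟩
  refine ⟨hzero, fun e => ?_, hne⟩
  obtain ⟨f, hf⟩ := hne e
  have hI := toMatroid_indep_iff.1 (hbase e f hf.symm).indep f (by simp)
  simp only [closure, Set.mem_ofPred_eq, not_forall] at hI
  obtain ⟨X, hX, hX0, hXf⟩ := hI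
  have hXe : X e = 0 := hX0 e ⟨by simp, fun h => hf h.symm⟩
  exact ⟨X, hX, hXe, fun g hg h => hXf (hzero X hX g e hg h hXe f)⟩

theorem IsTope.neg {T : SignVec E} (hT : M.IsTope T) : M.IsTope fun e => -T e := by
  refine ⟨M.neg_mem T hT.1, fun X hX h => ?_⟩
  have := hT.2 _ (M.neg_mem X hX) fun e he => by rw [← h e (by simpa using he), neg_neg]
  funext e
  rw [← this, neg_neg]

namespace IsUniformRankTwo

variable (hM : M.IsUniformRankTwo)
include hM

theorem isTope_iff {T : SignVec E} : M.IsTope T ↔ T ∈ M.covectors ∧ ∀ e, T e ≠ 0 := by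
  constructor
  · rintro ⟨hT, hmax⟩
    refine ⟨hT, fun e he => ?_⟩
    obtain ⟨f, hf⟩ := hM.exists_ne e
    obtain ⟨X, hX, -, hX'⟩ := hM.exists_cocircuit f
    have h := hmax _ (M.comp_mem T hT X hX) fun g hg => by simp [SignVec.comp, hg]
    have := congrFun h e
    simp only [SignVec.comp, he, if_true] at this
    exact hX' e hf.symm this
  · rintro ⟨hT, h0⟩
    exact ⟨hT, fun X _ h => funext fun e => (h e (h0 e)).symm⟩

/-- Eliminating a disagreement `g` would give a covector vanishing at both `e` and `g` but not at
`f`. -/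
theorem eq_of_common_zero {X Y : SignVec E} (hX : X ∈ M.covectors) (hY : Y ∈ M.covectors) {e f : E}
    (hXe : X e = 0) (hYe : Y e = 0) (hf : X f = Y f) (hf0 : X f ≠ 0) : X = Y := by
  funext g
  by_contra hg
  have hfe : f ≠ e := by rintro rfl; exact hf0 hXe
  have hge : g ≠ e := by rintro rfl; exact hg (hXe.trans hYe.symm)
  have hXg : X g ≠ 0 := fun h => hf0 (hM.eq_zero X hX g e hge h hXe f)
  have hYg : Y g ≠ 0 := fun h => hf0 (hf ▸ hM.eq_zero Y hY g e hge h hYe f)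
  obtain ⟨Z, hZ, hZg, hZ'⟩ := M.elim X hX Y hY g
    ⟨hXg, (SignType.eq_or_eq_neg_of_ne_zero _ _ hXg hYg).resolve_left hg⟩
  have hZe : Z e = 0 := by
    rw [hZ' e fun h => h.1 hXe]
    simp [SignVec.comp, hXe, hYe]
  have hZf : Z f = X f := by
    rw [hZ' f fun h => SignType.ne_neg_of_ne_zero _ hf0 (by rw [hf]; exact hf ▸ h.2)]
    simp [SignVec.comp, hf0]
  exact hf0 (hZf ▸ hM.eq_zero Z hZ g e hge hZg hZe f)

/-! ### Linear and cyclic order of the topes -/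

/-- Each element is the only difference of two topes with a prescribed sign elsewhere. -/
theorem exists_adjacent_topes (f : E) {e : E} (he : e ≠ f) {s : SignType} (hs : s ≠ 0) :
    ∃ T T' : SignVec E, M.IsTope T ∧ M.IsTope T' ∧ T e = s ∧ T' e = s ∧ T' f = -T f ∧
      ∀ g, g ≠ f → T g = T' g := by
  obtain ⟨X, hX, hXf, hX0⟩ : ∃ X ∈ M.covectors, X f = 0 ∧ ∀ g, g ≠ f → X g ≠ 0 :=
    hM.exists_cocircuit f
  obtain ⟨D, hD, hDf, hD0, hDe⟩ :
      ∃ D ∈ M.covectors, D f = 0 ∧ (∀ g, g ≠ f → D g ≠ 0) ∧ D e = s := by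
    rcases SignType.eq_or_eq_neg_of_ne_zero _ _ hs (hX0 e he) with h | h
    · exact ⟨X, hX, hXf, hX0, h.symm⟩
    · exact ⟨_, M.neg_mem X hX, by simp [hXf], fun g hg => by simpa using hX0 g hg, h.symm⟩
  obtain ⟨Y, hY, -, hY0⟩ := hM.exists_cocircuit e
  have hYf := hY0 f he.symm
  -- `f` is the only zero of `D`, so composition only fills in the sign at `f`.
  have key : ∀ Z ∈ M.covectors, Z f ≠ 0 → M.IsTope (SignVec.comp D Z) := by
    intro Z hZ hZf
    refine hM.isTope_iff.2 ⟨M.comp_mem D hD Z hZ, fun g => ?_⟩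
    by_cases hg : g = f
    · subst hg; simpa [SignVec.comp, hDf] using hZf
    · simp [SignVec.comp, hD0 g hg]
  refine ⟨_, _, key Y hY hYf, key _ (M.neg_mem Y hY) (by simpa using hYf), ?_, ?_, ?_, ?_⟩
  · simp [SignVec.comp, hDe, hs]
  · simp [SignVec.comp, hDe, hs]
  · simp [SignVec.comp, hDf]
  · intro g hg; simp [SignVec.comp, hD0 g hg]

/-- The topes are linearly arranged on one side of an element: for a suitable order of the ground
set, reorientation `ρ`, and first element `e₀`, they are negative on initial segments. -/
theorem exists_enumeration [Fintype E] {n : ℕ} (hn : Fintype.card E = n) (e₀ : E) :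
    ∃ (ρ : E → SignType) (ε : Fin n ≃ E), (∀ e, ρ e ≠ 0) ∧
      (∀ T, M.IsTope T → T e₀ = -ρ e₀ →
        ∃ k : ℕ, 1 ≤ k ∧ k ≤ n ∧ ∀ i, T (ε i) = -ρ (ε i) ↔ (i : ℕ) < k) ∧
      ∀ k : ℕ, 1 ≤ k → k ≤ n → ∃ T, M.IsTope T ∧ ∀ i, T (ε i) = -ρ (ε i) ↔ (i : ℕ) < k := by
  classical
  obtain ⟨C, hC, hCe, hC0⟩ := hM.exists_cocircuit e₀
  set ρ : E → SignType := fun e => if e = e₀ then 1 else C e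
  have hρC : ∀ e, e ≠ e₀ → ρ e = C e := fun e h => by simp [ρ, h]
  have hρ : ∀ e, ρ e ≠ 0 := by
    intro e
    by_cases h : e = e₀
    · simp [ρ, h]
    · rw [hρC e h]; exact hC0 e h
  have hnρ : ∀ e, -ρ e ≠ 0 := fun e => by simpa using hρ e
  have hdich : ∀ T, M.IsTope T → ∀ e, T e ≠ -ρ e → T e = ρ e := fun T hT e h =>
    (SignType.eq_or_eq_neg_of_ne_zero _ _ ((hM.isTope_iff.1 hT).2 e) (hρ e)).resolve_right h
  have hne : ∀ e, ρ e ≠ -ρ e := fun e => SignType.ne_neg_of_ne_zero _ (hρ e)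
  -- Negative sets of topes on one side of `e₀` are nested: otherwise eliminating `e₀` between `T`
  -- and `-T'` gives a covector zero at `e₀` that agrees with `C` at `g` but not at `f`.
  have chain : ∀ T T', M.IsTope T → M.IsTope T' → T e₀ = -ρ e₀ → T' e₀ = -ρ e₀ →
      ∀ f g, T f = -ρ f → T g = ρ g → T' f = ρ f → T' g = -ρ g → False := by
    intro T T' hT hT' h0 h0' f g hf hg hf' hg'
    have hfe : f ≠ e₀ := by rintro rfl; exact hne _ (hf'.symm.trans h0')
    have hge : g ≠ e₀ := by rintro rfl; exact hne _ (hg.symm.trans h0)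
    obtain ⟨Z, hZ, hZ0, hZ'⟩ := M.elim T hT.1 _ hT'.neg.1 e₀
      ⟨(hM.isTope_iff.1 hT).2 _, by simp [h0, h0']⟩
    have hZf : Z f = -ρ f := by
      rw [hZ' f fun h => hne f (by simpa [hf, hf'] using h.2.symm)]
      simp [SignVec.comp, hf, hρ]
    have hZg : Z g = ρ g := by
      rw [hZ' g fun h => hne g (by simpa [hg, hg'] using h.2)]
      simp [SignVec.comp, hg, hρ]
    have := hM.eq_of_common_zero hZ hC hZ0 hCe (hZg.trans (hρC g hge)) (hZg ▸ hρ g)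
    exact hne f (by rw [← hZf, this, hρC f hfe])
  -- Earlier elements turn negative first; `e₀` is least because it is negative throughout this
  -- side.
  let le : E → E → Prop := fun f g =>
    ∀ T, M.IsTope T → T e₀ = -ρ e₀ → T g = -ρ g → T f = -ρ f
  have sep : ∀ f, f ≠ e₀ → ∃ T T' : SignVec E, M.IsTope T ∧ M.IsTope T' ∧ T e₀ = -ρ e₀ ∧
      T' e₀ = -ρ e₀ ∧ T f = -ρ f ∧ T' f = ρ f ∧ ∀ g, g ≠ f → T g = T' g := by
    intro f hf
    obtain ⟨T, T', hT, hT', h1, h2, h3, h4⟩ := hM.exists_adjacent_topes f hf.symm (hnρ e₀)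
    by_cases h : T f = -ρ f
    · exact ⟨T, T', hT, hT', h1, h2, h, by rw [h3, h, neg_neg], h4⟩
    · have h' := hdich T hT f h
      exact ⟨T', T, hT', hT, h2, h1, by rw [h3, h'], h', fun g hg => (h4 g hg).symm⟩
  have lesep : ∀ f g, f ≠ g → f ≠ e₀ → le f g → le g f → False := by
    intro f g hfg hf h1 h2
    obtain ⟨T, T', hT, hT', a, b, c, d, h⟩ := sep f hf
    have := h2 T hT a c
    have := h1 T' hT' b (h g hfg.symm ▸ this)
    exact hne f (d.symm.trans this)
  let _ : LinearOrder E :=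
    { le := le
      le_refl := fun _ _ _ _ h => h
      le_trans := fun a b c h1 h2 T hT h0 h => h1 T hT h0 (h2 T hT h0 h)
      le_antisymm := by
        intro f g h1 h2
        by_contra hfg
        by_cases hf : f = e₀
        · exact lesep g f (Ne.symm hfg) (fun h => hfg (hf.trans h.symm)) h2 h1
        · exact lesep f g hfg hf h1 h2
      le_total := by
        intro f g
        by_contra! hc
        simp only [le, not_forall] at hc
        obtain ⟨⟨T, hT, h0, hg, hf⟩, ⟨T', hT', h0', hf', hg'⟩⟩ := hc
        exact chain T' T hT' hT h0' h0 f g hf' (hdich _ hT' _ hg') (hdich _ hT _ hf) hg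
      toDecidableLE := Classical.decRel _ }
  let ε := monoEquivOfFin E hn
  have hcut : ∀ T, M.IsTope T → T e₀ = -ρ e₀ →
      ∃ k : ℕ, 1 ≤ k ∧ k ≤ n ∧ ∀ i, T (ε i) = -ρ (ε i) ↔ (i : ℕ) < k := by
    intro T hT h0
    obtain ⟨k, hk, h⟩ := Fin.exists_forall_iff_lt_of_lower (fun i => T (ε i) = -ρ (ε i))
      fun i j hij => (ε.monotone hij : le (ε i) (ε j)) T hT h0
    have := (h (ε.symm e₀)).1 (by simpa using h0)
    exact ⟨k, by omega, hk, h⟩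
  refine ⟨ρ, ε.toEquiv, hρ, hcut, fun k hk1 hkn => ?_⟩
  have hmin : ∀ i, ε i = e₀ → (i : ℕ) = 0 := by
    intro i hi
    have h1 : ε i ≤ ε ⟨0, by omega⟩ := hi ▸ (fun _ _ h _ => h : le e₀ _)
    have h2 := Fin.le_def.1 (ε.le_iff_le.1 h1)
    simpa using h2
  rcases hkn.lt_or_eq with hkn | hkn
  -- `T'` is positive at position `k` but agrees with `T` at `k - 1`, where `T` is negative, so its
  -- cut is exactly `k`.
  · obtain ⟨T, T', hT, hT', a, b, c, d, h⟩ := sep (ε ⟨k, hkn⟩) fun h => by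
      have := hmin _ h; simp only at this; omega
    obtain ⟨m, hm1, hmn, hm⟩ := hcut T hT a
    obtain ⟨m', hm1', hmn', hm'⟩ := hcut T' hT' b
    have h1 := (hm _).1 c
    have h2 := mt (hm' ⟨k, hkn⟩).2 fun h => hne _ (d.symm.trans h)
    have h3 := (hm ⟨k - 1, by omega⟩).2 (by simp only at h1 ⊢; omega)
    rw [h _ fun h => by
      have := congrArg Fin.val (ε.injective h); simp only at this; omega] at h3
    have h4 := (hm' _).1 h3
    simp only at h1 h2 h4
    have : m' = k := by omega
    exact ⟨T', hT', this ▸ hm'⟩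
  -- For `k = n`, use the tope negative at the last element, which is not `e₀` since `1 < n`.
  · obtain ⟨f, hf⟩ := hM.exists_ne e₀
    have hn2 : 1 < n := by
      have h1 : ε.symm f ≠ ε.symm e₀ := fun h => hf (ε.symm.injective h)
      have h2 := Fin.val_ne_of_ne h1
      omega
    obtain ⟨T, T', hT, hT', a, b, c, d, h⟩ := sep (ε ⟨n - 1, by omega⟩) fun h => by
      have := hmin _ h; simp only at this; omega
    obtain ⟨m, hm1, hmn, hm⟩ := hcut T hT a
    have h1 := (hm _).1 c
    simp only at h1
    have : m = k := by omega
    exact ⟨T, hT, this ▸ hm⟩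

/-- The topes form a cycle of length `2 * n`, consecutive topes differing in one element, and the
elements are crossed in a cyclic order. -/
theorem exists_tope_cycle [Fintype E] {n : ℕ} (hn : Fintype.card E = n) (hpos : 0 < n) :
    ∃ (t : ℤ → SignVec E) (η : ℤ → E) (s : ℤ → SignType), (∀ k, M.IsTope (t k)) ∧
      (∀ T, M.IsTope T → ∃ k, T = t k) ∧ (∀ i j, η i = η j → i % n = j % n) ∧
      ∀ k j, t k (η j) = s j * blockSign n (k - j) := by
  obtain ⟨e₀⟩ : Nonempty E := Fintype.card_pos_iff.1 (hn ▸ hpos)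
  obtain ⟨ρ, ε, hρ, hcut, hreal⟩ := hM.exists_enumeration hn e₀
  have hn' : (0 : ℤ) < n := by omega
  -- For `1 ≤ k ≤ n` this is the tope with cut `k`; a shift by `n` negates it, giving the other side
  -- of `e₀`.
  let t : ℤ → SignVec E := fun k e => ρ e * blockSign n (k - (ε.symm e : ℕ))
  have hshift : ∀ k q, t (k + n * q) = fun e => (if Even q then 1 else -1) * t k e := by
    intro k q
    funext e
    simp only [t]
    rw [show k + n * q - ((ε.symm e : ℕ) : ℤ) = k - (ε.symm e : ℕ) + n * q by ring,
      blockSign_add_mul hpos, mul_left_comm]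
  have hdich : ∀ T, M.IsTope T → ∀ e, T e ≠ -ρ e → T e = ρ e := fun T hT e h =>
    (SignType.eq_or_eq_neg_of_ne_zero _ _ ((hM.isTope_iff.1 hT).2 e) (hρ e)).resolve_right h
  have hchar : ∀ T, M.IsTope T → ∀ k : ℕ, 1 ≤ k → k ≤ n →
      (∀ i, T (ε i) = -ρ (ε i) ↔ (i : ℕ) < k) → T = t k := by
    intro T hT k hk1 hkn h
    funext e
    have he := h (ε.symm e)
    rw [Equiv.apply_symm_apply] at he
    have hlt := (ε.symm e).2
    by_cases hc : (ε.symm e : ℕ) < k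
    · rw [he.2 hc]
      simp only [t]
      rw [blockSign_of_pos (by omega) (by omega), mul_neg_one]
    · rw [hdich T hT e (mt he.1 hc)]
      simp only [t]
      rw [blockSign_of_nonpos hpos (by omega) (by omega), mul_one]
  have hneg : ∀ k, t (k + n) = fun e => -t k e := by
    intro k
    have := hshift k 1
    simpa using this
  refine ⟨t, fun j => ε ⟨(j % n).toNat, by
      have := Int.emod_nonneg j hn'.ne'; have := Int.emod_lt_of_pos j hn'; omega⟩,
    -- The parity of `j / n` makes up for the sign change of `blockSign` under reduction of `j`
    -- modulo `n`.
    fun j => ρ (ε ⟨(j % n).toNat, by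
      have := Int.emod_nonneg j hn'.ne'; have := Int.emod_lt_of_pos j hn'; omega⟩) *
      (if Even (j / n) then 1 else -1), fun k => ?_, fun T hT => ?_, fun i j h => ?_,
    fun k j => ?_⟩
  · have hbase : ∀ m : ℕ, 1 ≤ m → m ≤ n → M.IsTope (t m) := by
      intro m h1 h2
      obtain ⟨T, hT, h⟩ := hreal m h1 h2
      exact hchar T hT m h1 h2 h ▸ hT
    have h1 := Int.emod_nonneg (k - 1) hn'.ne'
    have h2 := Int.emod_lt_of_pos (k - 1) hn'
    have h3 := hbase ((k - 1) % n + 1).toNat (by omega) (by omega)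
    rw [Int.toNat_of_nonneg (by omega)] at h3
    have h4 := hshift ((k - 1) % n + 1) ((k - 1) / n)
    rw [show (k - 1) % n + 1 + n * ((k - 1) / n) = k by
      have := Int.emod_add_mul_ediv (k - 1) n; linarith] at h4
    rw [h4]
    split_ifs
    · simpa using h3
    · simpa using h3.neg
  · by_cases h : T e₀ = -ρ e₀
    · obtain ⟨k, h1, h2, hk⟩ := hcut T hT h
      exact ⟨k, hchar T hT k h1 h2 hk⟩
    · obtain ⟨k, h1, h2, hk⟩ := hcut _ hT.neg (by rw [hdich T hT _ h])
      refine ⟨k + n, ?_⟩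
      rw [hneg, ← hchar _ hT.neg k h1 h2 hk]
      simp
  · have := congrArg Fin.val (ε.injective h)
    have := Int.emod_nonneg j hn'.ne'
    have := Int.emod_nonneg i hn'.ne'
    simp only at *
    omega
  · have h1 := Int.emod_nonneg j hn'.ne'
    simp only [t, Equiv.symm_apply_apply]
    rw [Int.toNat_of_nonneg h1, show k - j % n = k - j + n * (j / n) by
      have := Int.emod_add_mul_ediv j n; linarith, blockSign_add_mul hpos, mul_assoc]

end IsUniformRankTwo

end OrientedMatroid

/-! ### Cutting the cycle at the crossing -/

theorem theorem5 {E : Type*} [Fintype E] (n : ℕ) (hn : Fintype.card E = n)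
    (M : OrientedMatroid E) (hunif : M.IsUniform) (hrank : M.rank = 2)
    (T : Fin n → SignVec E) (hT : ∀ i, M.IsTope (T i)) :
    ∃ T' : SignVec E, M.IsTope T' ∧
      ∃ σ : Fin n → E, Function.Injective σ ∧ ∀ i, T' (σ i) = T i (σ i) := by
  have hM := OrientedMatroid.isUniformRankTwo hunif hrank
  have hpos : 0 < n := by
    obtain ⟨B, hB⟩ := M.toMatroid.exists_isBase
    have h2 : B.encard = 2 := by rw [hB.encard_eq_eRank]; exact hrank
    obtain ⟨x, -⟩ := Set.encard_eq_two.1 h2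
    exact hn ▸ Fintype.card_pos_iff.2 ⟨x⟩
  obtain ⟨t, η, s, ht, htope, hη, hts⟩ := hM.exists_tope_cycle hn hpos
  choose p hp using fun i => htope (T i) (hT i)
  obtain ⟨a, hright, hleft⟩ := exists_unique_crossing hpos p
  have hrep : ∀ i, ∃ m d : ℤ, p i + 2 * n * m = a + d ∧ -n < d ∧ d ≤ n := by
    intro i
    have h1 := Int.emod_nonneg (p i - a + n - 1) (by omega : (2 * n : ℤ) ≠ 0)
    have h2 := Int.emod_lt_of_pos (p i - a + n - 1) (by omega : (0 : ℤ) < 2 * n)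
    have h3 := Int.emod_add_mul_ediv (p i - a + n - 1) (2 * n)
    refine ⟨-((p i - a + n - 1) / (2 * n)), (p i - a + n - 1) % (2 * n) - n + 1, ?_, ?_, ?_⟩
    · linarith
    · omega
    · omega
  choose m d hmd hd1 hd2 using hrep
  have hcard := fun {x y : ℤ} (hxy : x ≤ y) => card_add_residueWalk_le hpos p hxy
  -- The step at `a` goes down, so no `p i` is congruent to `a`.
  have hd0 : ∀ i, d i ≠ 0 := by
    intro i hi
    have h1 := hcard (by omega : a ≤ a + 1) {i} fun j hj => by
      rw [Finset.mem_singleton] at hj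
      subst hj
      have := hmd j
      exact ⟨m j, by omega, by omega⟩
    have h2 := hleft a le_rfl
    rw [Finset.card_singleton] at h1
    push_cast at h1
    omega
  obtain ⟨f, hf, hfd⟩ := exists_injective_fin_two_sided (Fintype.card_fin n)
    (fun i => (d i).toNat) (fun i => (-d i).toNat)
    (fun i => by have := hd0 i; omega)
    (fun k _ => by
      -- The `k + 1` positions from `a` to `a + k` lower the walk by at least one, so they carry at
      -- most `k` indices.
      have h1 := hcard (by omega : a ≤ a + k + 1)
        (Finset.univ.filter fun i => 1 ≤ (d i).toNat ∧ (d i).toNat ≤ k) fun i hi => by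
          have := (Finset.mem_filter.1 hi).2
          have := hmd i
          exact ⟨m i, by omega, by omega⟩
      have h2 := hright (a + k + 1) (by omega)
      omega)
    (fun k _ => by
      have h1 := hcard (by omega : a - k ≤ a + 1)
        (Finset.univ.filter fun i => 1 ≤ (-d i).toNat ∧ (-d i).toNat ≤ k) fun i hi => by
          have := (Finset.mem_filter.1 hi).2
          have := hmd i
          exact ⟨m i, by omega, by omega⟩
      have h2 := hleft (a - k) (by omega)
      omega)
  refine ⟨t (a + n), ht _, fun i => η (a + (f i : ℕ)), fun i j h => ?_, fun i => ?_⟩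
  · have h2 : (((f i : ℕ) : ℤ) - (f j : ℕ)) % n = 0 := by
      have := Int.emod_eq_emod_iff_emod_sub_eq_zero.1 (hη _ _ h)
      rwa [add_sub_add_left_eq_sub] at this
    have h3 := Int.eq_zero_of_abs_lt_dvd (Int.dvd_of_emod_eq_zero h2)
      (abs_lt.2 ⟨by have := (f i).2; have := (f j).2; omega,
        by have := (f i).2; have := (f j).2; omega⟩)
    exact hf (Fin.ext (by omega))
  · rw [hp i, hts, hts]
    congr 1
    have hfi := (f i).2
    have h1 := blockSign_add_mul hpos (p i - (a + (f i : ℕ))) (2 * m i)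
    rw [if_pos (even_two_mul _), one_mul, show p i - (a + (f i : ℕ)) + n * (2 * m i) =
      d i - (f i : ℕ) by linarith [hmd i]] at h1
    rw [← h1, blockSign_of_pos (by omega) (by omega)]
    rcases hfd i with h | h
    · rw [blockSign_of_pos (by omega) (by have := hd2 i; omega)]
    -- For a negative offset, a full turn `2 * n` brings the argument into `[1, n]`.
    · have h2 := blockSign_add_mul hpos (d i - (f i : ℕ)) 2
      rw [if_pos even_two, one_mul] at h2
      rw [← h2, blockSign_of_pos]
      · have := hd1 i; omega
      · omega
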